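/- **Network.** Let $(N,E)$ be a finite connected graph whose lines are given an arbitrary orientation (so $(i,j)\in E$ implies $(j,i)\notin E$), with constants $B_{ij}=B_{ji}$, $B_{ij}>0$ for $(i,j)\in E$, and, for $j\in N$, $M_j,\tau_j,A_j,\alpha_j,\overline d_j>0$, thresholds $\omega^1_j>\omega^0_j>0$, and $p^L_j,\underline p^c_j\in\mathbb R$. Put $p^c=-\sum_{j\in N}p^L_j$. The state is $\zeta=(x,\sigma)$ with $x=(\eta,\omega,p^M)\in\mathbb R^{|E|}\times\mathbb R^{|N|}\times\mathbb R^{|N|}$ and $\sigma\in\{0,1\}^{|N|}$; let $\Lambda$ be the set of all such states. **Flow.** On the set $F$ of states in $\Lambda$ such that, for every $j\in N$: $\sigma_j=1$ if $\omega_j>\omega^1_j$; $\sigma_j=0$ if $\omega_j<\omega^0_j$ and $p^c<\underline p^c_j$ (and $\sigma_j\in\{0,1\}$ is arbitrary otherwise), the state satisfies $\dot\zeta=\tilde f(\zeta)$, that is, $$\dot\eta_{ij}=\omega_i-\omega_j\ \ ((i,j)\in E),\qquad \tau_j\dot p^M_j=-(p^M_j+\alpha_j\omega_j),\qquad \dot\sigma_j=0\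 \ (j\in N),$$ $$M_j\dot\omega_j=-p^L_j+p^M_j-(\overline d_j\sigma_j+A_j\omega_j)-\sum_{k:(j,k)\in E}B_{jk}\eta_{jk}+\sum_{i:(i,j)\in E}B_{ij}\eta_{ij}\ \ (j\in N).$$ **Jumps.** Let $\tilde G$ be the set of states in $\Lambda$ such that, for at least one $j\in N$, either $\sigma_j=0$ and $\omega_j=\omega^1_j$; or $\sigma_j=1$, $\omega_j\le\omega^0_j$ and $p^c=\underline p^c_j$; or $\sigma_j=1$, $\omega_j=\omega^0_j$ and $p^c\le\underline p^c_j$. On $G=(\Lambda\setminus F)\cup\tilde G$ the state is updated by $\zeta^+=\tilde g(\zeta)$: $x^+=x$ and, for each $j\in N$, $\sigma_j^+=1$ if $\omega_j\ge\omega^1_j$; $\sigma_j^+=0$ if $\omega_j\le\omega^0_j$ and $p^c\le\underline p^c_j$; and $\sigma_j^+=\sigma_j$ otherwise. **Solutions.** A hybrid time domain is a set $K\subseteq\mathbb R_{\ge0}\times\mathbb N_0$ containing $(0,0)$ that is a union of a finite or infinite sequence of intervals $[t_l,t_{l+1}]\times\{l\}$, $0=t_0\le t_1\le\dots$, where the last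 interval, if there is one, may also have the form $[t_l,t_{l+1})\times\{l\}$ or $[t_l,\infty)\times\{l\}$. A solution is a function $\zeta$ on a hybrid time domain $K$ such that $\zeta(0,0)\in F\cup G$; for every $l$, $t\mapsto\zeta(t,l)$ is locally absolutely continuous on $T_l=\{t:(t,l)\in K\}$; for every $l$ such that $T_l$ has non-empty interior, $\zeta(t,l)\in F$ for all $t\in\operatorname{int}T_l$ and $\dot\zeta(t,l)=\tilde f(\zeta(t,l))$ for almost all $t\in T_l$; and, whenever $(t,l),(t,l+1)\in K$, $\zeta(t,l)\in G$ and $\zeta(t,l+1)=\tilde g(\zeta(t,l))$. It is complete if $K$ is unbounded, maximal if it is not the restriction of a solution whose time domain properly contains $K$, and bounded if its set of values is bounded. Load $j$ switches at $(t,l)$ if $(t,l),(t,l+1)\in K$ and $\sigma_j(t,l)\neq\sigma_j(t,l+1)$. **Proposition.** (i) For every $\zeta_0\in\Lambda$ there is a complete solution with $\zeta(0,0)=\zeta_0$. (ii) Every maximal solution is complete. (iii) For every complete bounded solution there is $\tau>0$ such that, for every $j\in N$, if load $j$ switches at $(t,l)$ and its next switch is at $(t',l')$, then $t'-t\ge\tau$.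 -/

import Mathlib

open MeasureTheory Set
open scoped Topology

noncomputable section

/-! ### Hybrid systems and their solutions -/

/-- A hybrid system: flow set `C`, flow map `f` (used on `C`), jump set `D`, jump map `g`
(used on `D`). -/
structure HybridSystem (X : Type*) where
  C : Set X
  f : X → X
  D : Set X
  g : X → X

/-- `K ⊆ ℝ≥0 × ℕ` is a hybrid time domain: a union of an infinite sequence of intervals
`[t l, t (l+1)] × {l}`, or of a finite one whose last member is `[t L, t (L+1)] × {L}`,
`[t L, t (L+1)) × {L}` or `[t L, ∞) × {L}`; time starts at `(0, 0) ∈ K`. -/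
def IsHybridTimeDomain (K : Set (ℝ × ℕ)) : Prop :=
  (0, 0) ∈ K ∧
  ∃ t : ℕ → ℝ, t 0 = 0 ∧ Monotone t ∧
    (K = (⋃ l : ℕ, Icc (t l) (t (l + 1)) ×ˢ {l}) ∨
      ∃ (L : ℕ) (I : Set ℝ),
        (I = Icc (t L) (t (L + 1)) ∨ I = Ico (t L) (t (L + 1)) ∨ I = Ici (t L)) ∧
        K = (⋃ l < L, Icc (t l) (t (l + 1)) ×ˢ {l}) ∪ I ×ˢ {L})

/-- The slice `T_l = {t : (t, l) ∈ K}`. -/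
def timeSlice (K : Set (ℝ × ℕ)) (l : ℕ) : Set ℝ := {t | (t, l) ∈ K}

namespace HybridSystem

variable {X : Type*} [NormedAddCommGroup X] [NormedSpace ℝ X]

/-- `ζ`, restricted to the hybrid time domain `K`, is a solution of `H`.
(Values of `ζ` outside `K` are irrelevant.) -/
structure IsSolution (H : HybridSystem X) (K : Set (ℝ × ℕ)) (ζ : ℝ → ℕ → X) : Prop where
  timeDomain : IsHybridTimeDomain K
  /-- `t ↦ ζ t l` is locally absolutely continuous on `T_l`. -/
  locallyAC : ∀ l a b, a ≤ b → Icc a b ⊆ timeSlice K l →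
    AbsolutelyContinuousOnInterval (fun t => ζ t l) a b
  init : ζ 0 0 ∈ H.C ∪ H.D
  flow_mem : ∀ l, ∀ t ∈ interior (timeSlice K l), ζ t l ∈ H.C
  flow_deriv : ∀ l, (interior (timeSlice K l)).Nonempty →
    ∀ᵐ t ∂(volume.restrict (timeSlice K l)), HasDerivAt (fun s => ζ s l) (H.f (ζ t l)) t
  jump_mem : ∀ t l, (t, l) ∈ K → (t, l + 1) ∈ K → ζ t l ∈ H.D
  jump_eq : ∀ t l, (t, l) ∈ K → (t, l + 1) ∈ K → ζ t (l + 1) = H.g (ζ t l)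

/-- The hybrid time domain of a complete solution is unbounded. -/
def IsCompleteDomain (K : Set (ℝ × ℕ)) : Prop := ¬ Bornology.IsBounded K

/-- A maximal solution: a solution with no proper extension that is a solution. -/
def IsMaximalSolution (H : HybridSystem X) (K : Set (ℝ × ℕ)) (ζ : ℝ → ℕ → X) : Prop :=
  H.IsSolution K ζ ∧
    ¬ ∃ (K' : Set (ℝ × ℕ)) (ζ' : ℝ → ℕ → X), H.IsSolution K' ζ' ∧ K ⊂ K' ∧
      ∀ t l, (t, l) ∈ K → ζ t l = ζ' t l

/-- The set of values of `ζ` on `K` is bounded. -/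
def IsBoundedOn (K : Set (ℝ × ℕ)) (ζ : ℝ → ℕ → X) : Prop :=
  Bornology.IsBounded ((fun p : ℝ × ℕ => ζ p.1 p.2) '' K)

end HybridSystem

/-! ### The power network with hysteretic loads -/

/-- Parameters of the power network with on-off loads: a connected graph on the finite set of
buses `N`, with arbitrarily oriented lines `E`, and the physical and control constants. -/
structure PowerNetwork (N : Type*) [Fintype N] where
  /-- oriented transmission lines -/
  E : Finset (N × N)
  oriented : ∀ i j, (i, j) ∈ E → (j, i) ∉ E
  connected : (SimpleGraph.fromRel fun i j => (i, j) ∈ E).Connected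
  /-- line susceptances -/
  B : N → N → ℝ
  B_symm : ∀ i j, B i j = B j i
  B_pos : ∀ i j, (i, j) ∈ E → 0 < B i j
  /-- generator inertia -/
  M : N → ℝ
  M_pos : ∀ j, 0 < M j
  /-- generation time constants -/
  τ : N → ℝ
  τ_pos : ∀ j, 0 < τ j
  /-- damping coefficients -/
  A : N → ℝ
  A_pos : ∀ j, 0 < A j
  /-- droop coefficients -/
  α : N → ℝ
  α_pos : ∀ j, 0 < α j
  /-- uncontrollable (constant) demand -/
  pL : N → ℝ
  /-- magnitude of the on-off load -/
  dbar : N → ℝ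
  dbar_pos : ∀ j, 0 < dbar j
  /-- switch-off frequency threshold -/
  ω0 : N → ℝ
  /-- switch-on frequency threshold -/
  ω1 : N → ℝ
  ω0_pos : ∀ j, 0 < ω0 j
  ω0_lt_ω1 : ∀ j, ω0 j < ω1 j
  /-- power command thresholds -/
  pcLow : N → ℝ

namespace PowerNetwork

variable {N : Type*} [Fintype N] [DecidableEq N] (P : PowerNetwork N)

/-- The ambient real space of the states `ζ = (η, ω, pᴹ, σ)`. -/
abbrev State : Type _ := (P.E → ℝ) × (N → ℝ) × (N → ℝ) × (N → ℝ)

variable {P} in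
/-- angle differences -/
def State.η (ζ : P.State) : P.E → ℝ := ζ.1

variable {P} in
/-- frequency deviations -/
def State.ω (ζ : P.State) : N → ℝ := ζ.2.1

variable {P} in
/-- mechanical power injections -/
def State.pM (ζ : P.State) : N → ℝ := ζ.2.2.1

variable {P} in
/-- switching states of the loads -/
def State.σ (ζ : P.State) : N → ℝ := ζ.2.2.2

/-- The state space `Λ = ℝⁿ × {0,1}^N`. -/
def Lam : Set P.State := {ζ | ∀ j, State.σ ζ j ∈ ({0, 1} : Set ℝ)}

/-- The power command `p^c = -∑ p^L_j`. -/
def pc : ℝ := - ∑ j, P.pL j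

/-- The power transfer `p_ij = B_ij η_ij`. -/
def transfer (ζ : P.State) (e : P.E) : ℝ := P.B e.1.1 e.1.2 * State.η ζ e

/-- The flow map: swing equations, generation dynamics, and `σ` constant. -/
def flowMap (ζ : P.State) : P.State :=
  (fun e => State.ω ζ e.1.1 - State.ω ζ e.1.2,
   fun j => (P.M j)⁻¹ * (- P.pL j + State.pM ζ j
      - (P.dbar j * State.σ ζ j + P.A j * State.ω ζ j)
      - (∑ e : P.E with e.1.1 = j, P.transfer ζ e)
      + (∑ e : P.E with e.1.2 = j, P.transfer ζ e)),
   fun j => - (P.τ j)⁻¹ * (State.pM ζ j + P.α j * State.ω ζ j),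
   fun _ => 0)

open Classical in
/-- Values of `σ_j` compatible with flow at frequency `w`. The last case is exactly:
`ω⁰_j ≤ w ≤ ω¹_j`, or `w ≤ ω⁰_j` and `p^c ≥ pcLow_j`. -/
def flowValues (j : N) (w : ℝ) : Set ℝ :=
  if P.ω1 j < w then {1}
  else if w < P.ω0 j ∧ P.pc < P.pcLow j then {0}
  else {0, 1}

/-- Values of `σ_j` that trigger a jump at a threshold (empty away from the thresholds). -/
def thresholdValues (j : N) (w : ℝ) : Set ℝ :=
  {s | (s = 0 ∧ w = P.ω1 j) ∨
    (s = 1 ∧ ((w ≤ P.ω0 j ∧ P.pc = P.pcLow j) ∨ (w = P.ω0 j ∧ P.pc ≤ P.pcLow j)))}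

/-- The flow set `F`. -/
def flowSet : Set P.State :=
  {ζ | ζ ∈ P.Lam ∧ ∀ j, State.σ ζ j ∈ P.flowValues j (State.ω ζ j)}

/-- The jump set `G`: the states of `Λ` outside `F`, and those where some load is at a
switching threshold. -/
def jumpSet : Set P.State :=
  (P.Lam \ P.flowSet) ∪
    {ζ | ζ ∈ P.Lam ∧ ∃ j, State.σ ζ j ∈ P.thresholdValues j (State.ω ζ j)}

open Classical in
/-- The jump map: `x` is unchanged, every load whose switching condition is met switches,
every other load keeps its state. -/
def jumpMap (ζ : P.State) : P.State :=
  (State.η ζ, State.ω ζ, State.pM ζ,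
   fun j =>
    if P.ω1 j ≤ State.ω ζ j then 1
    else if State.ω ζ j ≤ P.ω0 j ∧ P.pc ≤ P.pcLow j then 0
    else State.σ ζ j)

/-- The hybrid system of the network with the adapted hysteretic loads. -/
def adaptedSystem : HybridSystem P.State where
  C := P.flowSet
  f := P.flowMap
  D := P.jumpSet
  g := P.jumpMap

variable {P} in
/-- Load `j` changes its state `σ_j` at time `t`, at the jump from index `l` to `l + 1`. -/
def IsSwitch (K : Set (ℝ × ℕ)) (ζ : ℝ → ℕ → P.State) (j : N) (t : ℝ) (l : ℕ) : Prop :=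
  (t, l) ∈ K ∧ (t, l + 1) ∈ K ∧ State.σ (ζ t l) j ≠ State.σ (ζ t (l + 1)) j

variable {P} in
/-- Load `j` switches at `(t, l)` and, as its next switch, at `(t', l')`. -/
def IsConsecutiveSwitches (K : Set (ℝ × ℕ)) (ζ : ℝ → ℕ → P.State) (j : N)
    (t : ℝ) (l : ℕ) (t' : ℝ) (l' : ℕ) : Prop :=
  IsSwitch K ζ j t l ∧ IsSwitch K ζ j t' l' ∧ l < l' ∧
    ∀ s m, l < m → m < l' → ¬ IsSwitch K ζ j s m

end PowerNetwork

end

/-! The flow map is affine, hence Lipschitz: a global trajectory passes through every state, and by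
uniqueness each absolutely continuous arc of a solution is a piece of one (`eqOn_isTrajectory`).
Trajectories keep `σ` constant, so they stay in Λ, and a state of Λ outside F lies in G. For fixed
`σ`, `mem_jumpSet_iff` describes G by non-strict inequalities in `ω`, so a trajectory meets G at a
closed set of times.

Existence: flow to the first hitting time of G, jump, and repeat, until some trajectory remains in F
forever. Infinitely many jumps already make the time domain unbounded, so accumulation of jump times
need not be excluded.

Maximality: if the domain were bounded, the last arc could be flowed up to its right endpoint, so
that endpoint belongs to the domain. There the state is either in G, and a jump prolongs the
solution, or in the complement of G, which is open along the trajectory, and flow prolongs it.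

Dwell time: consecutive switches of a load have opposite directions, so its frequency crosses the
hysteresis band between them. Jumps do not move `ω`, and on a bounded solution the flow map is
bounded, so each crossing takes a time bounded below (`σ_eq_and_ω_sub_le`). -/

/-! ### Affine differential equations -/

section AffineODE

variable {X : Type*} [NormedAddCommGroup X] [NormedSpace ℝ X]

/-- An affine vector field has a global integral curve through every point. -/
theorem exists_hasDerivAt_affine [CompleteSpace X] (A : X →L[ℝ] X) (c : X) (t₀ : ℝ) (x₀ : X) :
    ∃ φ : ℝ → X, φ t₀ = x₀ ∧ ∀ t, HasDerivAt φ (A (φ t) + c) t := by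
  -- Homogenization: an extra coordinate, constantly 1, carries the term `c`, so the matrix
  -- exponential of a linear field on `X × ℝ` solves the affine equation.
  let M : X × ℝ →L[ℝ] X × ℝ :=
    ((A.comp (ContinuousLinearMap.fst ℝ X ℝ)) +
      (ContinuousLinearMap.snd ℝ X ℝ).smulRight c).prod 0
  let y : ℝ → X × ℝ := fun t => NormedSpace.exp ((t - t₀) • M) (x₀, 1)
  have hy : ∀ t, HasDerivAt y (M (y t)) t := fun t => by
    have h := (hasDerivAt_exp_smul_const' (𝕂 := ℝ) M (t - t₀)).comp_sub_const t t₀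
    have h2 := ((ContinuousLinearMap.apply ℝ (X × ℝ) ((x₀, 1) : X × ℝ)).hasFDerivAt).comp_hasDerivAt
      t h
    exact h2
  have hy0 : y t₀ = (x₀, 1) := by simp [y]
  have h2 : ∀ t, HasDerivAt (fun s => (y s).2) 0 t := fun t =>
    (ContinuousLinearMap.snd ℝ X ℝ).hasFDerivAt.comp_hasDerivAt t (hy t)
  have h3 : ∀ t, (y t).2 = 1 := fun t => by
    have := is_const_of_deriv_eq_zero (fun t => (h2 t).differentiableAt)
      (fun t => (h2 t).deriv) t t₀
    simpa [hy0] using this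
  refine ⟨fun t => (y t).1, by simp [hy0], fun t => ?_⟩
  have h1 := (ContinuousLinearMap.fst ℝ X ℝ).hasFDerivAt.comp_hasDerivAt t (hy t)
  refine h1.congr_deriv ?_
  simp [M, h3]

/-- A Carathéodory solution of a Lipschitz differential equation is a classical one. -/
theorem AbsolutelyContinuousOnInterval.eqOn_of_hasDerivAt [CompleteSpace X] {K : NNReal}
    {f : X → X} (hf : LipschitzWith K f) {y φ : ℝ → X} {a b : ℝ} (hab : a ≤ b)
    (hy : AbsolutelyContinuousOnInterval y a b)
    (hy' : ∀ᵐ t ∂(volume.restrict (Icc a b)), HasDerivAt y (f (y t)) t)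
    (hφ : ∀ t, HasDerivAt φ (f (φ t)) t) (h0 : y a = φ a) : EqOn y φ (Icc a b) := by
  have hyc : ContinuousOn y (Icc a b) := by simpa [uIcc_of_le hab] using hy.continuousOn
  -- Freezing `y` outside `[a, b]` makes the integrand continuous on all of ℝ, so its primitive `Y`
  -- is C¹. Then `y - Y` is absolutely continuous with derivative zero almost everywhere, hence
  -- constant.
  let z : ℝ → X := fun t => f (IccExtend hab ((Icc a b).domRestrict y) t)
  have hz : Continuous z := hf.continuous.comp (hyc.domRestrict.Icc_extend')
  have hzy : ∀ t ∈ Icc a b, z t = f (y t) := fun t ht => by simp [z, IccExtend_of_mem hab _ ht]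
  let Y : ℝ → X := fun t => ∫ s in a..t, z s
  have hY : ∀ t, HasDerivAt Y (z t) t := fun t => hz.integral_hasStrictDerivAt a t |>.hasDerivAt
  have hYac : AbsolutelyContinuousOnInterval Y a b := by
    refine ContDiffOn.absolutelyContinuousOnInterval (ContDiff.contDiffOn ?_)
    refine contDiff_one_iff_deriv.2 ⟨fun t => (hY t).differentiableAt, ?_⟩
    rwa [show deriv Y = z from funext fun t => (hY t).deriv]
  obtain ⟨C, hC⟩ := (hy.sub hYac).const_of_ae_hasDerivAt_zero (by
    rw [ae_restrict_iff' measurableSet_Icc] at hy'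
    filter_upwards [hy'] with t ht htm
    rw [uIcc_of_le hab] at htm
    simpa [hzy t htm] using (ht htm).sub (hY t))
  rw [uIcc_of_le hab] at hC
  have hyC : ∀ t ∈ Icc a b, y t = C + Y t := fun t ht => by
    rw [← hC t ht]; simp
  -- The representative `C + Y` of `y` solves the equation at every time, so classical uniqueness
  -- applies.
  have hd : ∀ t ∈ Ico a b, HasDerivWithinAt (fun t => C + Y t) (f (C + Y t)) (Ici t) t :=
    fun t ht => by
    have := (hY t).const_add C
    rw [hzy t (Ico_subset_Icc_self ht), hyC t (Ico_subset_Icc_self ht)] at this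
    exact this.hasDerivWithinAt
  have := ODE_solution_unique (v := fun _ => f) (fun _ => hf)
    (f := fun t => C + Y t) (g := φ) (a := a) (b := b)
    (fun t _ => ((hY t).continuousAt.const_add C).continuousWithinAt) hd
    (fun t _ => (hφ t).continuousAt.continuousWithinAt)
    (fun t _ => (hφ t).hasDerivWithinAt)
    (by rw [← h0, hyC a (left_mem_Icc.2 hab)])
  intro t ht
  exact (hyC t ht).trans (this ht)

end AffineODE

namespace PowerNetwork

variable {N : Type*} [Fintype N] {P : PowerNetwork N}

/-! ### The jump set and the jump map -/

variable (P) in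
theorem jumpSet_subset_Lam : P.jumpSet ⊆ P.Lam := by
  rintro z (h | h)
  exacts [h.1, h.1]

variable (P) in
theorem flowSet_union_jumpSet : P.flowSet ∪ P.jumpSet = P.Lam := by
  refine Subset.antisymm (union_subset (fun z h => h.1) P.jumpSet_subset_Lam) fun z hz => ?_
  by_cases h : z ∈ P.flowSet
  exacts [Or.inl h, Or.inr (Or.inl ⟨hz, h⟩)]

theorem mem_flowSet_of_notMem_jumpSet {z : P.State} (hz : z ∈ P.Lam) (h : z ∉ P.jumpSet) :
    z ∈ P.flowSet :=
  (P.flowSet_union_jumpSet.ge hz).resolve_right h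

/-- The jump set consists of the states in which the switching condition of some load is met. -/
theorem mem_jumpSet_iff {z : P.State} (hz : z ∈ P.Lam) :
    z ∈ P.jumpSet ↔ ∃ j, (State.σ z j = 0 ∧ P.ω1 j ≤ State.ω z j) ∨
      (State.σ z j = 1 ∧ State.ω z j ≤ P.ω0 j ∧ P.pc ≤ P.pcLow j) := by
  have hmem : z ∈ P.jumpSet ↔ ∃ j, State.σ z j ∉ P.flowValues j (State.ω z j) ∨
      State.σ z j ∈ P.thresholdValues j (State.ω z j) := by
    simp [jumpSet, flowSet, hz, exists_or]
  rw [hmem]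
  refine exists_congr fun j => ?_
  have h01 := P.ω0_lt_ω1 j
  have h0 := hz j
  simp only [mem_insert_iff, mem_singleton_iff] at h0
  simp only [flowValues, thresholdValues]
  -- The complement of F supplies the strict inequalities and the threshold values supply the
  -- equality cases; together they form the closed conditions.
  rcases h0 with h | h <;> split_ifs with h1 h2 <;> simp [h] <;> grind

theorem jumpMap_mem_Lam {z : P.State} (hz : z ∈ P.Lam) : P.jumpMap z ∈ P.Lam := by
  intro j
  have := hz j
  simp only [jumpMap, State.σ] at this ⊢
  split_ifs <;> simp_all

/-- A change of `σ` must come from one of the first two branches of the jump map, so the direction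
of a switch determines which threshold the frequency has reached. -/
theorem σ_jumpMap_cases {z : P.State} (hz : z ∈ P.Lam) {j : N}
    (h : State.σ z j ≠ State.σ (P.jumpMap z) j) :
    (State.σ z j = 0 ∧ State.σ (P.jumpMap z) j = 1 ∧ P.ω1 j ≤ State.ω z j) ∨
      (State.σ z j = 1 ∧ State.σ (P.jumpMap z) j = 0 ∧ State.ω z j ≤ P.ω0 j) := by
  have h0 := hz j
  simp only [jumpMap, State.σ] at h0 h ⊢
  split_ifs at h ⊢ <;> simp_all

/-! ### The flow of the network -/

variable [DecidableEq N]

variable (P) in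
/-- The flow map is affine. -/
theorem exists_flowMap_eq_affine :
    ∃ (A : P.State →L[ℝ] P.State) (c : P.State), ∀ ζ, P.flowMap ζ = A ζ + c := by
  let A : P.State →ₗ[ℝ] P.State :=
    { toFun := fun ζ => P.flowMap ζ - P.flowMap 0
      map_add' := fun x y => by
        refine Prod.ext ?_ (Prod.ext ?_ (Prod.ext ?_ ?_)) <;> funext i <;>
          simp [flowMap, transfer, State.η, State.ω, State.pM, State.σ, mul_add,
            Finset.sum_add_distrib] <;> ring
      map_smul' := fun r x => by
        refine Prod.ext ?_ (Prod.ext ?_ (Prod.ext ?_ ?_)) <;> funext i <;>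
          simp [flowMap, transfer, State.η, State.ω, State.pM, State.σ, mul_left_comm _ r,
            ← Finset.mul_sum] <;> ring }
  exact ⟨LinearMap.toContinuousLinearMap A, P.flowMap 0, fun ζ => by simp [A]⟩

variable (P) in
theorem exists_lipschitzWith_flowMap : ∃ K, LipschitzWith K P.flowMap := by
  obtain ⟨A, c, h⟩ := P.exists_flowMap_eq_affine
  refine ⟨‖A‖₊, LipschitzWith.of_dist_le_mul fun x y => ?_⟩
  rw [h, h, dist_add_right]
  exact A.lipschitz.dist_le_mul x y

/-- A globally defined classical solution of the network equations. -/
def IsTrajectory (φ : ℝ → P.State) : Prop := ∀ t, HasDerivAt φ (P.flowMap (φ t)) t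

variable (P) in
theorem exists_isTrajectory (t₀ : ℝ) (z : P.State) :
    ∃ φ : ℝ → P.State, φ t₀ = z ∧ IsTrajectory φ := by
  obtain ⟨A, c, h⟩ := P.exists_flowMap_eq_affine
  obtain ⟨φ, h0, hφ⟩ := exists_hasDerivAt_affine A c t₀ z
  exact ⟨φ, h0, fun t => by rw [h]; exact hφ t⟩

namespace IsTrajectory

variable {φ : ℝ → P.State}

theorem continuous (hφ : IsTrajectory φ) : Continuous φ :=
  continuous_iff_continuousAt.2 fun t => (hφ t).continuousAt

theorem comp_sub_const (hφ : IsTrajectory φ) (a : ℝ) : IsTrajectory fun t => φ (t - a) :=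
  fun t => (hφ (t - a)).comp_sub_const t a

theorem absolutelyContinuousOnInterval (hφ : IsTrajectory φ) (a b : ℝ) :
    AbsolutelyContinuousOnInterval φ a b := by
  refine ContDiffOn.absolutelyContinuousOnInterval (ContDiff.contDiffOn ?_)
  refine contDiff_one_iff_deriv.2 ⟨fun t => (hφ t).differentiableAt, ?_⟩
  rw [show deriv φ = fun t => P.flowMap (φ t) from funext fun t => (hφ t).deriv]
  obtain ⟨K, hK⟩ := P.exists_lipschitzWith_flowMap
  exact hK.continuous.comp hφ.continuous

theorem σ_eq (hφ : IsTrajectory φ) (s t : ℝ) : State.σ (φ s) = State.σ (φ t) := by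
  have h : ∀ t, HasDerivAt (fun s => (φ s).2.2.2) 0 t := fun t =>
    (hφ t).hasFDerivAt.snd.snd.snd.hasDerivAt.congr_deriv (by simp [flowMap]; rfl)
  exact is_const_of_deriv_eq_zero (fun t => (h t).differentiableAt) (fun t => (h t).deriv) s t

theorem mem_Lam (hφ : IsTrajectory φ) {s : ℝ} (h : φ s ∈ P.Lam) (t : ℝ) : φ t ∈ P.Lam := by
  intro j
  rw [hφ.σ_eq t s]
  exact h j

end IsTrajectory

/-- Along a trajectory, the jump set is reached at a closed set of times. -/
theorem IsTrajectory.isClosed_jumpSet {φ : ℝ → P.State} (hφ : IsTrajectory φ)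
    (h : φ 0 ∈ P.Lam) : IsClosed {t | φ t ∈ P.jumpSet} := by
  -- Since `σ` is constant along the trajectory, it can be read at time 0, leaving only non-strict
  -- inequalities in the continuous functions `ω_j`.
  have hset : {t | φ t ∈ P.jumpSet} =
      ⋃ j, ({t | State.σ (φ 0) j = 0 ∧ P.ω1 j ≤ State.ω (φ t) j} ∪
        {t | State.σ (φ 0) j = 1 ∧ State.ω (φ t) j ≤ P.ω0 j ∧ P.pc ≤ P.pcLow j}) := by
    ext t
    simp only [mem_ofPred_eq, mem_jumpSet_iff (hφ.mem_Lam h t), hφ.σ_eq t 0, mem_iUnion, mem_union]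
  have hω : ∀ j, Continuous fun t => State.ω (φ t) j := fun j =>
    (continuous_apply j).comp (hφ.continuous.snd.fst)
  rw [hset]
  refine isClosed_iUnion_of_finite fun j => IsClosed.union ?_ ?_
  · exact isClosed_const.and (isClosed_le continuous_const (hω j))
  · exact isClosed_const.and ((isClosed_le (hω j) continuous_const).and isClosed_const)

end PowerNetwork

/-! ### Hybrid time domains -/

theorem mem_timeSlice {K : Set (ℝ × ℕ)} {t : ℝ} {l : ℕ} : t ∈ timeSlice K l ↔ (t, l) ∈ K := Iff.rfl

/-- The hybrid time domain with slices `[t l, t (l+1)]` for `l < L` and last slice `I`. -/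
def finiteTimeDomain (t : ℕ → ℝ) (L : ℕ) (I : Set ℝ) : Set (ℝ × ℕ) :=
  (⋃ l < L, Icc (t l) (t (l + 1)) ×ˢ {l}) ∪ I ×ˢ {L}

theorem mem_finiteTimeDomain {t : ℕ → ℝ} {L : ℕ} {I : Set ℝ} {s : ℝ} {m : ℕ} :
    (s, m) ∈ finiteTimeDomain t L I ↔
      (m < L ∧ s ∈ Icc (t m) (t (m + 1))) ∨ (m = L ∧ s ∈ I) := by
  simp only [finiteTimeDomain, mem_union, mem_iUnion, mem_prod, mem_singleton_iff, exists_prop]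
  grind

theorem timeSlice_finiteTimeDomain_of_lt {t : ℕ → ℝ} {L : ℕ} {I : Set ℝ} {m : ℕ} (h : m < L) :
    timeSlice (finiteTimeDomain t L I) m = Icc (t m) (t (m + 1)) := by
  ext s
  simp [timeSlice, mem_finiteTimeDomain, h, h.ne]

theorem timeSlice_finiteTimeDomain_self {t : ℕ → ℝ} {L : ℕ} {I : Set ℝ} :
    timeSlice (finiteTimeDomain t L I) L = I := by
  ext s
  simp [timeSlice, mem_finiteTimeDomain]

theorem timeSlice_finiteTimeDomain_of_gt {t : ℕ → ℝ} {L : ℕ} {I : Set ℝ} {m : ℕ} (h : L < m) :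
    timeSlice (finiteTimeDomain t L I) m = ∅ := by
  ext s
  simp [timeSlice, mem_finiteTimeDomain, h.ne', h.le]

/-- The hybrid time domain with slices `[t l, t (l+1)]` for all `l`. -/
def infiniteTimeDomain (t : ℕ → ℝ) : Set (ℝ × ℕ) := ⋃ l : ℕ, Icc (t l) (t (l + 1)) ×ˢ {l}

theorem timeSlice_infiniteTimeDomain {t : ℕ → ℝ} (m : ℕ) :
    timeSlice (infiniteTimeDomain t) m = Icc (t m) (t (m + 1)) := by
  ext s
  simp only [timeSlice, infiniteTimeDomain, mem_ofPred_eq, mem_iUnion, mem_prod,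
    mem_singleton_iff]
  grind

/-- The jump index alone is unbounded, even if the times `t l` converge. -/
theorem isCompleteDomain_infiniteTimeDomain {t : ℕ → ℝ} (ht : Monotone t) :
    HybridSystem.IsCompleteDomain (infiniteTimeDomain t) := by
  intro hb
  obtain ⟨C, hC⟩ := Metric.isBounded_iff.1 hb
  obtain ⟨n, hn⟩ := exists_nat_gt C
  have hmem : ∀ l, (t l, l) ∈ infiniteTimeDomain t := fun l => by
    rw [← mem_timeSlice, timeSlice_infiniteTimeDomain]
    exact left_mem_Icc.2 (ht l.le_succ)
  have h := hC (hmem n) (hmem 0)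
  have h2 : dist n 0 ≤ dist (t n, n) (t 0, 0) := le_max_right _ _
  rw [Nat.dist_eq] at h2
  simp at h2
  linarith

theorem isCompleteDomain_of_Ici_subset {K : Set (ℝ × ℕ)} {a : ℝ} {l : ℕ}
    (h : Ici a ⊆ timeSlice K l) : HybridSystem.IsCompleteDomain K := by
  intro hb
  obtain ⟨C, hC⟩ := Metric.isBounded_iff.1 hb
  have h1 := hC (h (mem_Ici.2 (by linarith [abs_nonneg C] : a ≤ a + (|C| + 1))))
    (h (self_mem_Ici (a := a)))
  have h2 : dist (a + (|C| + 1)) a ≤ dist (a + (|C| + 1), l) (a, l) := le_max_left _ _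
  rw [Real.dist_eq, add_sub_cancel_left, abs_of_pos (by positivity)] at h2
  linarith [le_abs_self C]

/-- Slices of a hybrid time domain are intervals which begin where the previous one ends. -/
theorem IsHybridTimeDomain.exists_slices {K : Set (ℝ × ℕ)} (hK : IsHybridTimeDomain K) :
    ∃ t : ℕ → ℝ, Monotone t ∧
      (∀ l, (timeSlice K l).OrdConnected ∧ timeSlice K l ⊆ Ici (t l) ∧
        ((timeSlice K l).Nonempty → t l ∈ timeSlice K l)) ∧
      ∀ l, (timeSlice K (l + 1)).Nonempty → timeSlice K l = Icc (t l) (t (l + 1)) := by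
  obtain ⟨-, t, -, ht, h⟩ := hK
  have hIcc : ∀ l, (Icc (t l) (t (l + 1))).OrdConnected ∧ Icc (t l) (t (l + 1)) ⊆ Ici (t l) ∧
      ((Icc (t l) (t (l + 1))).Nonempty → t l ∈ Icc (t l) (t (l + 1))) := fun l =>
    ⟨ordConnected_Icc, Icc_subset_Ici_self, fun _ => left_mem_Icc.2 (ht l.le_succ)⟩
  refine ⟨t, ht, ?_⟩
  rcases h with rfl | ⟨L, I, hI, rfl⟩
  · change (∀ l, _ ∧ timeSlice (infiniteTimeDomain t) l ⊆ _ ∧ _) ∧ _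
    exact ⟨fun l => (timeSlice_infiniteTimeDomain (t := t) l).symm ▸ hIcc l,
      fun l _ => timeSlice_infiniteTimeDomain l⟩
  · change (∀ l, (timeSlice (finiteTimeDomain t L I) l).OrdConnected ∧
        timeSlice (finiteTimeDomain t L I) l ⊆ Ici (t l) ∧
        ((timeSlice (finiteTimeDomain t L I) l).Nonempty →
          t l ∈ timeSlice (finiteTimeDomain t L I) l)) ∧
      ∀ l, (timeSlice (finiteTimeDomain t L I) (l + 1)).Nonempty →
        timeSlice (finiteTimeDomain t L I) l = Icc (t l) (t (l + 1))
    refine ⟨fun l => ?_, fun l hl => ?_⟩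
    · rcases lt_trichotomy l L with h | rfl | h
      · rw [timeSlice_finiteTimeDomain_of_lt h]
        exact hIcc l
      · rw [timeSlice_finiteTimeDomain_self]
        rcases hI with rfl | rfl | rfl
        · exact hIcc l
        · exact ⟨ordConnected_Ico, Ico_subset_Ici_self, fun h => left_mem_Ico.2 (nonempty_Ico.1 h)⟩
        · exact ⟨ordConnected_Ici, Subset.rfl, fun _ => self_mem_Ici⟩
      · rw [timeSlice_finiteTimeDomain_of_gt h]
        exact ⟨ordConnected_empty, empty_subset _, fun h => absurd h not_nonempty_empty⟩
    · refine timeSlice_finiteTimeDomain_of_lt (lt_of_not_ge fun h => ?_)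
      rw [timeSlice_finiteTimeDomain_of_gt (Nat.lt_succ_of_le h)] at hl
      exact not_nonempty_empty hl

/-- A bounded hybrid time domain has a last slice, which is a bounded non-empty interval. -/
theorem IsHybridTimeDomain.exists_eq_finiteTimeDomain {K : Set (ℝ × ℕ)}
    (hK : IsHybridTimeDomain K) (hb : ¬ HybridSystem.IsCompleteDomain K) :
    ∃ (t : ℕ → ℝ) (L : ℕ) (I : Set ℝ), t 0 = 0 ∧ Monotone t ∧ K = finiteTimeDomain t L I ∧
      t L ∈ I ∧ (I = Icc (t L) (t (L + 1)) ∨ I = Ico (t L) (t (L + 1))) := by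
  obtain ⟨h0, t, ht0, ht, h⟩ := hK
  rcases h with rfl | ⟨L, I, hI, rfl⟩
  · exact absurd (isCompleteDomain_infiniteTimeDomain ht) hb
  · change (0, 0) ∈ finiteTimeDomain t L I at h0
    change ¬ HybridSystem.IsCompleteDomain (finiteTimeDomain t L I) at hb
    change ∃ (t' : ℕ → ℝ) (L' : ℕ) (I' : Set ℝ), t' 0 = 0 ∧ Monotone t' ∧
      finiteTimeDomain t L I = finiteTimeDomain t' L' I' ∧ _
    rcases hI with rfl | rfl | rfl
    · exact ⟨t, L, _, ht0, ht, rfl, left_mem_Icc.2 (ht L.le_succ), Or.inl rfl⟩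
    · rcases (ht L.le_succ).lt_or_eq with hlt | heq
      · exact ⟨t, L, _, ht0, ht, rfl, left_mem_Ico.2 hlt, Or.inr rfl⟩
      -- Here the half-open last slice is empty. For `L = 0` this contradicts `(0, 0) ∈ K`;
      -- otherwise the preceding closed slice is the true last one.
      · rcases L with _ | L
        · simp [mem_finiteTimeDomain, ← heq] at h0
        · refine ⟨t, L, _, ht0, ht, ?_, left_mem_Icc.2 (ht L.le_succ), Or.inl rfl⟩
          ext ⟨s, m⟩
          simp only [mem_finiteTimeDomain, ← heq, Ico_self, mem_empty_iff_false]
          grind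
    · exact absurd (isCompleteDomain_of_Ici_subset
        (timeSlice_finiteTimeDomain_self (t := t) (L := L)).ge) hb

theorem isHybridTimeDomain_infiniteTimeDomain {t : ℕ → ℝ} (h0 : t 0 = 0) (ht : Monotone t) :
    IsHybridTimeDomain (infiniteTimeDomain t) := by
  refine ⟨?_, t, h0, ht, Or.inl rfl⟩
  rw [← mem_timeSlice, timeSlice_infiniteTimeDomain]
  exact ⟨h0.le, h0 ▸ ht (Nat.zero_le _)⟩

theorem isHybridTimeDomain_finiteTimeDomain {t : ℕ → ℝ} (h0 : t 0 = 0) (ht : Monotone t) (L : ℕ)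
    {I : Set ℝ} (hI : I = Icc (t L) (t (L + 1)) ∨ I = Ici (t L)) :
    IsHybridTimeDomain (finiteTimeDomain t L I) := by
  refine ⟨?_, t, h0, ht, Or.inr ⟨L, I, by tauto, rfl⟩⟩
  rw [mem_finiteTimeDomain]
  rcases L.eq_zero_or_pos with rfl | hL
  · refine Or.inr ⟨rfl, ?_⟩
    rcases hI with rfl | rfl
    exacts [⟨h0.le, h0 ▸ ht (Nat.zero_le _)⟩, h0.le]
  · exact Or.inl ⟨hL, h0.le, h0 ▸ ht (Nat.zero_le _)⟩

namespace PowerNetwork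

variable {N : Type*} [Fintype N] [DecidableEq N] {P : PowerNetwork N}

/-! ### Solutions and trajectories -/

/-- On each slice, a solution is a trajectory. -/
theorem eqOn_isTrajectory {K : Set (ℝ × ℕ)} {ζ : ℝ → ℕ → P.State}
    (h : P.adaptedSystem.IsSolution K ζ) {l : ℕ} {a : ℝ} (hS : (timeSlice K l).OrdConnected)
    (ha : a ∈ timeSlice K l) (hSa : timeSlice K l ⊆ Ici a) {φ : ℝ → P.State}
    (hφ : IsTrajectory φ) (h0 : φ a = ζ a l) : ∀ t ∈ timeSlice K l, ζ t l = φ t := by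
  intro t ht
  rcases (mem_Ici.1 (hSa ht)).eq_or_lt with rfl | hlt
  · exact h0.symm
  have hsub : Icc a t ⊆ timeSlice K l := hS.out ha ht
  have hne : (interior (timeSlice K l)).Nonempty :=
    (nonempty_Ioo.2 hlt).mono (interior_maximal (Ioo_subset_Icc_self.trans hsub) isOpen_Ioo)
  obtain ⟨C, hC⟩ := P.exists_lipschitzWith_flowMap
  exact (h.locallyAC l a t hlt.le hsub).eqOn_of_hasDerivAt hC hlt.le
    (ae_restrict_of_ae_restrict_of_subset hsub (h.flow_deriv l hne)) hφ h0.symm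
    (right_mem_Icc.2 hlt.le)

/-- A function which follows a trajectory on every slice, and the jump map between slices, is a
solution. -/
theorem isSolution_of_isTrajectory {K : Set (ℝ × ℕ)} {ζ : ℝ → ℕ → P.State}
    (hK : IsHybridTimeDomain K) (h0 : ζ 0 0 ∈ P.Lam)
    (hζ : ∀ l, IsTrajectory fun t => ζ t l)
    (hF : ∀ l, ∀ t ∈ interior (timeSlice K l), ζ t l ∈ P.flowSet)
    (hG : ∀ t l, (t, l) ∈ K → (t, l + 1) ∈ K → ζ t l ∈ P.jumpSet)
    (hg : ∀ t l, (t, l) ∈ K → (t, l + 1) ∈ K → ζ t (l + 1) = P.jumpMap (ζ t l)) :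
    P.adaptedSystem.IsSolution K ζ where
  timeDomain := hK
  locallyAC l a b _ _ := (hζ l).absolutelyContinuousOnInterval a b
  init := P.flowSet_union_jumpSet.ge h0
  flow_mem := hF
  flow_deriv l _ := Filter.Eventually.of_forall (hζ l)
  jump_mem := hG
  jump_eq := hg

/-! ### Existence of complete solutions -/

/-- A trajectory from `Λ` can flow until it reaches the jump set. -/
theorem IsTrajectory.exists_first_jump {φ : ℝ → P.State} (hφ : IsTrajectory φ)
    (h : φ 0 ∈ P.Lam) (hF : ¬ ∀ t, 0 ≤ t → φ t ∈ P.flowSet) :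
    ∃ s, 0 ≤ s ∧ φ s ∈ P.jumpSet ∧ ∀ t, 0 ≤ t → t < s → φ t ∈ P.flowSet := by
  let S : Set ℝ := Ici 0 ∩ {t | φ t ∈ P.jumpSet}
  have hS : IsClosed S := isClosed_Ici.inter (hφ.isClosed_jumpSet h)
  have hb : BddBelow S := ⟨0, fun t ht => ht.1⟩
  have hne : S.Nonempty := by
    push Not at hF
    obtain ⟨t, ht, hnt⟩ := hF
    by_contra hS
    exact hnt (mem_flowSet_of_notMem_jumpSet (hφ.mem_Lam h t) fun h => hS ⟨t, ht, h⟩)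
  have hs := hS.csInf_mem hne hb
  exact ⟨sInf S, hs.1, hs.2, fun t ht hts => mem_flowSet_of_notMem_jumpSet (hφ.mem_Lam h t)
    fun h => (csInf_le hb ⟨ht, h⟩).not_gt hts⟩

-- Arcs are glued by recursion on the jump index: `Z l` is the state at the start of arc `l`, `d`
-- the waiting time before its jump, and `T` the accumulated time.
variable (P) in
theorem exists_complete_solution (z₀ : P.State) (hz₀ : z₀ ∈ P.Lam) :
    ∃ (K : Set (ℝ × ℕ)) (ζ : ℝ → ℕ → P.State),
      P.adaptedSystem.IsSolution K ζ ∧ ζ 0 0 = z₀ ∧ HybridSystem.IsCompleteDomain K := by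
  choose Φ hΦ0 hΦ using P.exists_isTrajectory 0
  -- The waiting time 0 is a dummy value for states that can flow forever; it only keeps `T`
  -- monotone.
  have hd : ∀ z : P.Lam, ∃ s, 0 ≤ s ∧ ((¬ ∀ t, 0 ≤ t → Φ z t ∈ P.flowSet) →
      Φ z s ∈ P.jumpSet ∧ ∀ t, 0 ≤ t → t < s → Φ z t ∈ P.flowSet) := fun z => by
    by_cases h : ∀ t, 0 ≤ t → Φ z t ∈ P.flowSet
    · exact ⟨0, le_rfl, fun h' => absurd h h'⟩
    · obtain ⟨s, h0, h1, h2⟩ := (hΦ z).exists_first_jump ((hΦ0 z).symm ▸ z.2) h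
      exact ⟨s, h0, fun _ => ⟨h1, h2⟩⟩
  choose d hd0 hd using hd
  have hΦL : ∀ (z : P.Lam) t, Φ z t ∈ P.Lam := fun z t =>
    (hΦ z).mem_Lam (s := 0) ((hΦ0 z).symm ▸ z.2) t
  let Z : ℕ → P.Lam := fun l => Nat.rec ⟨z₀, hz₀⟩
    (fun _ z => ⟨P.jumpMap (Φ z (d z)), jumpMap_mem_Lam (hΦL z _)⟩) l
  let T : ℕ → ℝ := fun l => ∑ k ∈ Finset.range l, d (Z k)
  have hT0 : T 0 = 0 := Finset.sum_range_zero _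
  have hTs : ∀ l, T (l + 1) = T l + d (Z l) := fun l => Finset.sum_range_succ _ _
  have hT : Monotone T := monotone_nat_of_le_succ fun l => by
    rw [hTs]; linarith [hd0 (Z l)]
  let ζ : ℝ → ℕ → P.State := fun t l => Φ (Z l).1 (t - T l)
  have hζ0 : ζ 0 0 = z₀ := by
    change Φ z₀ (0 - T 0) = z₀
    rw [hT0, sub_zero, hΦ0]
  have hζ : ∀ l, IsTrajectory fun t => ζ t l := fun l => (hΦ _).comp_sub_const _
  have hinit : ζ 0 0 ∈ P.Lam := hζ0.symm ▸ hz₀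
  have hjump : ∀ l, ζ (T (l + 1)) (l + 1) = P.jumpMap (ζ (T (l + 1)) l) := fun l => by
    change Φ (P.jumpMap (Φ (Z l).1 (d (Z l)))) (T (l + 1) - T (l + 1)) =
      P.jumpMap (Φ (Z l).1 (T (l + 1) - T l))
    rw [sub_self, hΦ0, hTs, add_sub_cancel_left]
  have hmem : ∀ l, (¬ ∀ t, 0 ≤ t → Φ (Z l).1 t ∈ P.flowSet) →
      ζ (T (l + 1)) l ∈ P.jumpSet := fun l h => by
    change Φ (Z l).1 (T (l + 1) - T l) ∈ _
    rw [hTs, add_sub_cancel_left]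
    exact (hd (Z l) h).1
  have hflow : ∀ l, (¬ ∀ t, 0 ≤ t → Φ (Z l).1 t ∈ P.flowSet) →
      ∀ t ∈ interior (Icc (T l) (T (l + 1))), ζ t l ∈ P.flowSet := fun l h t ht => by
    rw [interior_Icc, hTs] at ht
    exact (hd (Z l) h).2 _ (by linarith [ht.1]) (by linarith [ht.2])
  by_cases hL : ∃ L, ∀ t, 0 ≤ t → Φ (Z L).1 t ∈ P.flowSet
  · classical
    -- The first arc that can flow forever becomes the unbounded last slice; all earlier arcs end
    -- with a jump.
    let L := Nat.find hL
    have hlt : ∀ l < L, ¬ ∀ t, 0 ≤ t → Φ (Z l).1 t ∈ P.flowSet := fun l h => Nat.find_min hL h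
    have heq : ∀ t l, (t, l) ∈ finiteTimeDomain T L (Ici (T L)) →
        (t, l + 1) ∈ finiteTimeDomain T L (Ici (T L)) → l < L ∧ t = T (l + 1) := by
      intro t l h1 h2
      rw [mem_finiteTimeDomain] at h1 h2
      have hl : l < L := by rcases h2 with h2 | h2 <;> omega
      refine ⟨hl, le_antisymm (h1.resolve_right fun h => hl.ne h.1).2.2 ?_⟩
      rcases h2 with h2 | h2
      exacts [h2.2.1, h2.1 ▸ h2.2]
    refine ⟨finiteTimeDomain T L (Ici (T L)), ζ, isSolution_of_isTrajectory
      (isHybridTimeDomain_finiteTimeDomain hT0 hT L (Or.inr rfl)) hinit hζ ?_ ?_ ?_, hζ0,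
      isCompleteDomain_of_Ici_subset timeSlice_finiteTimeDomain_self.ge⟩
    · intro l t ht
      rcases lt_trichotomy l L with h | rfl | h
      · rw [timeSlice_finiteTimeDomain_of_lt h] at ht
        exact hflow l (hlt l h) t ht
      · rw [timeSlice_finiteTimeDomain_self] at ht
        exact Nat.find_spec hL _ (sub_nonneg.2 (interior_subset ht))
      · rw [timeSlice_finiteTimeDomain_of_gt h, interior_empty] at ht
        exact ht.elim
    · intro t l h1 h2
      obtain ⟨hl, rfl⟩ := heq t l h1 h2
      exact hmem l (hlt l hl)
    · intro t l h1 h2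
      obtain ⟨hl, rfl⟩ := heq t l h1 h2
      exact hjump l
  · rw [not_exists] at hL
    have heq : ∀ t l, (t, l) ∈ infiniteTimeDomain T → (t, l + 1) ∈ infiniteTimeDomain T →
        t = T (l + 1) := by
      intro t l h1 h2
      rw [← mem_timeSlice, timeSlice_infiniteTimeDomain] at h1 h2
      exact le_antisymm h1.2 h2.1
    refine ⟨infiniteTimeDomain T, ζ, isSolution_of_isTrajectory
      (isHybridTimeDomain_infiniteTimeDomain hT0 hT) hinit hζ ?_ ?_ ?_, hζ0,
      isCompleteDomain_infiniteTimeDomain hT⟩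
    · intro l t ht
      rw [timeSlice_infiniteTimeDomain] at ht
      exact hflow l (hL l) t ht
    · intro t l h1 h2
      obtain rfl := heq t l h1 h2
      exact hmem l (hL l)
    · intro t l h1 h2
      obtain rfl := heq t l h1 h2
      exact hjump l

/-! ### Dwell time -/

/-- Along a solution, the state of a load changes only at its switches, and the variation of the
frequencies is bounded in terms of a bound on the flow map. -/
theorem σ_eq_and_ω_sub_le {K : Set (ℝ × ℕ)} {ζ : ℝ → ℕ → P.State}
    (h : P.adaptedSystem.IsSolution K ζ) {C : ℝ}
    (hC : ∀ t l, (t, l) ∈ K → ‖P.flowMap (ζ t l)‖ ≤ C) {j : N} {t : ℝ} {l l' : ℕ}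
    (ht : IsSwitch K ζ j t l) (hl : ∀ s m, l < m → m < l' → ¬ IsSwitch K ζ j s m) {s : ℝ} {m : ℕ}
    (hlm : l + 1 ≤ m) (hml : m ≤ l') (hs : (s, m) ∈ K) :
    State.σ (ζ s m) j = State.σ (ζ t (l + 1)) j ∧
      |State.ω (ζ s m) j - State.ω (ζ t l) j| ≤ C * (s - t) := by
  obtain ⟨T, hTm, hT, hTs⟩ := h.timeDomain.exists_slices
  -- Within one slice the solution is a trajectory, so `σ` is constant and the mean value inequality
  -- controls `ω`. The induction on `m` then chains the slices, as jumps leave `ω` unchanged.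
  have hflow : ∀ m s, (s, m) ∈ K → State.σ (ζ s m) j = State.σ (ζ (T m) m) j ∧
      |State.ω (ζ s m) j - State.ω (ζ (T m) m) j| ≤ C * (s - T m) := by
    intro m s hs
    obtain ⟨hoc, hge, hne⟩ := hT m
    have hTm := hne ⟨s, hs⟩
    obtain ⟨φ, hφ0, hφ⟩ := P.exists_isTrajectory (T m) (ζ (T m) m)
    have heq := eqOn_isTrajectory h hoc hTm hge hφ hφ0
    rw [heq s hs, heq _ hTm, hφ.σ_eq s (T m)]
    refine ⟨rfl, ?_⟩
    have := hoc.convex.norm_image_sub_le_of_norm_hasDerivWithin_le (f := φ)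
      (fun x _ => (hφ x).hasDerivWithinAt) (fun x hx => heq x hx ▸ hC x m hx) hTm hs
    rw [Real.norm_eq_abs, abs_of_nonneg (sub_nonneg.2 (hge hs))] at this
    refine le_trans ?_ this
    calc |State.ω (φ s) j - State.ω (φ (T m)) j| = ‖(φ s - φ (T m)).2.1 j‖ := rfl
      _ ≤ ‖(φ s - φ (T m)).2.1‖ := norm_le_pi_norm _ _
      _ ≤ ‖(φ s - φ (T m)).2‖ := norm_fst_le _
      _ ≤ ‖φ s - φ (T m)‖ := norm_snd_le _
  have hstart : ∀ m s, (s, m) ∈ K → (s, m + 1) ∈ K → s = T (m + 1) := fun m s h1 h2 => by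
    have := hTs m ⟨s, h2⟩
    exact le_antisymm (this.le h1).2 ((hT (m + 1)).2.1 h2)
  have hω : ∀ m s, (s, m) ∈ K → (s, m + 1) ∈ K →
      State.ω (ζ s (m + 1)) j = State.ω (ζ s m) j := fun m s h1 h2 => by
    rw [h.jump_eq s m h1 h2]; rfl
  induction m, hlm using Nat.le_induction generalizing s with
  | base =>
    have := hflow _ _ hs
    rw [← hstart l t ht.1 ht.2.1, hω l t ht.1 ht.2.1] at this
    exact this
  | succ m hlm ih =>
    obtain ⟨h1, h2⟩ := hflow _ _ hs
    have hT' : (T (m + 1), m + 1) ∈ K := (hT (m + 1)).2.2 ⟨s, hs⟩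
    have hT'' : (T (m + 1), m) ∈ K := (hTs m ⟨s, hs⟩).ge (right_mem_Icc.2 (hTm m.le_succ))
    obtain ⟨h3, h4⟩ := ih (by omega) hT''
    have hns : State.σ (ζ (T (m + 1)) m) j = State.σ (ζ (T (m + 1)) (m + 1)) j := by
      by_contra hne
      exact hl _ m (by omega) (by omega) ⟨hT'', hT', hne⟩
    rw [hω m _ hT'' hT'] at h2
    refine ⟨by rw [h1, ← hns, h3], ?_⟩
    calc |State.ω (ζ s (m + 1)) j - State.ω (ζ t l) j|
        ≤ |State.ω (ζ s (m + 1)) j - State.ω (ζ (T (m + 1)) m) j| +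
          |State.ω (ζ (T (m + 1)) m) j - State.ω (ζ t l) j| := abs_sub_le _ _ _
      _ ≤ C * (s - T (m + 1)) + C * (T (m + 1) - t) := add_le_add h2 h4
      _ = C * (s - t) := by ring

end PowerNetwork

/-! ### Prolonging time domains and solutions -/

theorem isHybridTimeDomain_finiteTimeDomain_Icc {t : ℕ → ℝ} (h0 : t 0 = 0) (ht : Monotone t)
    (L : ℕ) {b : ℝ} (hb : t L ≤ b) : IsHybridTimeDomain (finiteTimeDomain t L (Icc (t L) b)) := by
  -- Only the breakpoints up to `L` are used by the domain, so the later ones may be replaced by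
  -- `b`.
  let t' : ℕ → ℝ := fun l => if l ≤ L then t l else b
  have ht' : Monotone t' := monotone_nat_of_le_succ fun l => by
    simp only [t']
    have := ht l.le_succ
    split_ifs with h1 h2 h2
    · exact this
    · exact (ht h1).trans hb
    · omega
    · exact le_rfl
  have heq : finiteTimeDomain t L (Icc (t L) b) = finiteTimeDomain t' L (Icc (t L) b) := by
    ext ⟨s, m⟩
    simp only [mem_finiteTimeDomain, t']
    grind
  rw [heq]
  exact isHybridTimeDomain_finiteTimeDomain (by simpa [t'] using h0) ht' L
    (Or.inl (by simp [t']))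

namespace PowerNetwork

variable {N : Type*} [Fintype N] [DecidableEq N] {P : PowerNetwork N}

/-- A solution stays a solution if it is modified, outside the slices which are kept, to follow
trajectories and the jump map. -/
theorem _root_.HybridSystem.IsSolution.modify {K K' : Set (ℝ × ℕ)} {ζ ζ' : ℝ → ℕ → P.State}
    (h : P.adaptedSystem.IsSolution K ζ) (hK : IsHybridTimeDomain K') (h0 : ζ' 0 0 = ζ 0 0)
    (hζ : ∀ l, (timeSlice K' l = timeSlice K l ∧ ∀ t, ζ' t l = ζ t l) ∨
      (IsTrajectory (fun t => ζ' t l) ∧ ∀ t ∈ interior (timeSlice K' l), ζ' t l ∈ P.flowSet))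
    (hG : ∀ t l, (t, l) ∈ K' → (t, l + 1) ∈ K' →
      ζ' t l ∈ P.jumpSet ∧ ζ' t (l + 1) = P.jumpMap (ζ' t l)) :
    P.adaptedSystem.IsSolution K' ζ' where
  timeDomain := hK
  locallyAC l a b hab hsub := by
    rcases hζ l with ⟨h1, h2⟩ | ⟨h1, -⟩
    · rw [show (fun t => ζ' t l) = fun t => ζ t l from funext h2]
      exact h.locallyAC l a b hab (h1 ▸ hsub)
    · exact h1.absolutelyContinuousOnInterval a b
  init := h0 ▸ h.init
  flow_mem l t ht := by
    rcases hζ l with ⟨h1, h2⟩ | ⟨-, h2⟩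
    · rw [h2]
      exact h.flow_mem l t (h1 ▸ ht)
    · exact h2 t ht
  flow_deriv l hl := by
    rcases hζ l with ⟨h1, h2⟩ | ⟨h1, -⟩
    · rw [show (fun t => ζ' t l) = fun t => ζ t l from funext h2, h1]
      simp only [h2]
      exact h.flow_deriv l (h1 ▸ hl)
    · exact Filter.Eventually.of_forall h1
  jump_mem t l h1 h2 := (hG t l h1 h2).1
  jump_eq t l h1 h2 := (hG t l h1 h2).2

/-! ### Maximal solutions -/

/-- A solution can be prolonged by flow as long as its last arc stays in the flow set. -/
theorem mem_of_isMaximalSolution {t : ℕ → ℝ} {L : ℕ} {I : Set ℝ} {ζ : ℝ → ℕ → P.State}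
    (h0 : t 0 = 0) (ht : Monotone t) (hL : t L ∈ I)
    (hI : I = Icc (t L) (t (L + 1)) ∨ I = Ico (t L) (t (L + 1)))
    (h : P.adaptedSystem.IsMaximalSolution (finiteTimeDomain t L I) ζ)
    {φ : ℝ → P.State} (hφ : IsTrajectory φ) (hφζ : ∀ s ∈ I, ζ s L = φ s) {b : ℝ}
    (hb : t (L + 1) ≤ b) (hF : ∀ s, t (L + 1) ≤ s → s < b → φ s ∈ P.flowSet) : b ∈ I := by
  by_contra hbI
  obtain ⟨hsol, hmax⟩ := h
  have hLb : t L ≤ b := (ht L.le_succ).trans hb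
  have hsub : I ⊆ Icc (t L) b := by
    rcases hI with rfl | rfl
    exacts [Icc_subset_Icc_right hb, Ico_subset_Icc_self.trans (Icc_subset_Icc_right hb)]
  have hint : Ioo (t L) (t (L + 1)) ⊆ interior I := by
    rcases hI with rfl | rfl
    exacts [interior_Icc.ge, interior_Ico.ge]
  refine hmax ⟨finiteTimeDomain t L (Icc (t L) b), fun s m => if m = L then φ s else ζ s m,
    hsol.modify (isHybridTimeDomain_finiteTimeDomain_Icc h0 ht L hLb) ?_ ?_ ?_,
    ⟨fun ⟨s, m⟩ hs => ?_, fun hss => ?_⟩, fun s m hs => ?_⟩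
  · split_ifs with hL0
    · subst hL0
      exact (hφζ 0 (h0 ▸ hL)).symm
    · rfl
  · intro l
    rcases lt_trichotomy l L with hl | rfl | hl
    · left
      simp [timeSlice_finiteTimeDomain_of_lt hl, hl.ne]
    · right
      simp only [if_true, timeSlice_finiteTimeDomain_self, interior_Icc]
      refine ⟨hφ, fun s hs => ?_⟩
      -- Before the old right endpoint the flow condition is inherited from the given solution; from
      -- that endpoint on, it is `hF`.
      rcases lt_or_ge s (t (l + 1)) with hsb | hsb
      · have hs' := hint ⟨hs.1, hsb⟩
        rw [← hφζ s (interior_subset hs')]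
        refine hsol.flow_mem l s ?_
        rwa [timeSlice_finiteTimeDomain_self]
      · exact hF s hsb hs.2
    · left
      simp [timeSlice_finiteTimeDomain_of_gt hl, hl.ne']
  · intro s l h1 h2
    rw [mem_finiteTimeDomain] at h1 h2
    have hl : l < L := by rcases h2 with h2 | h2 <;> omega
    have h1' : (s, l) ∈ finiteTimeDomain t L I :=
      mem_finiteTimeDomain.2 (Or.inl ⟨hl, (h1.resolve_right fun h => hl.ne h.1).2⟩)
    have h2' : (s, l + 1) ∈ finiteTimeDomain t L I := by
      refine mem_finiteTimeDomain.2 (h2.imp_right fun h2 => ⟨h2.1, ?_⟩)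
      have hs : s = t L := le_antisymm
        (h2.1 ▸ (h1.resolve_right fun h => hl.ne h.1).2.2) h2.2.1
      rwa [hs]
    have hζ' : (if l + 1 = L then φ s else ζ s (l + 1)) = ζ s (l + 1) := by
      split_ifs with h
      · subst h
        exact (hφζ s ((mem_finiteTimeDomain.1 h2').resolve_left (by simp)).2).symm
      · rfl
    simp only [hl.ne, if_false, hζ']
    exact ⟨hsol.jump_mem s l h1' h2', hsol.jump_eq s l h1' h2'⟩
  · exact mem_finiteTimeDomain.2
      ((mem_finiteTimeDomain.1 hs).imp_right fun h => ⟨h.1, hsub h.2⟩)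
  · have := hss (mem_finiteTimeDomain.2 (Or.inr ⟨rfl, right_mem_Icc.2 hLb⟩))
    rw [mem_finiteTimeDomain] at this
    exact hbI (this.resolve_left (by simp)).2
  · change ζ s m = if m = L then φ s else ζ s m
    split_ifs with hm
    · subst hm
      exact hφζ s ((mem_finiteTimeDomain.1 hs).resolve_left (by simp)).2
    · rfl

/-- A solution whose time domain ends in the jump set can be prolonged by a jump. -/
theorem notMem_jumpSet_of_isMaximalSolution {t : ℕ → ℝ} {L : ℕ} {ζ : ℝ → ℕ → P.State}
    (h0 : t 0 = 0) (ht : Monotone t)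
    (h : P.adaptedSystem.IsMaximalSolution (finiteTimeDomain t L (Icc (t L) (t (L + 1)))) ζ) :
    ζ (t (L + 1)) L ∉ P.jumpSet := by
  intro hjump
  obtain ⟨hsol, hmax⟩ := h
  -- The added slice is a single point, so its flow condition is vacuous; only the value of `ψ` at
  -- `t (L + 1)` matters.
  obtain ⟨ψ, hψ0, hψ⟩ := P.exists_isTrajectory (t (L + 1)) (P.jumpMap (ζ (t (L + 1)) L))
  have hmem : ∀ s m, (s, m) ∈ finiteTimeDomain t (L + 1) (Icc (t (L + 1)) (t (L + 1))) ↔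
      (s, m) ∈ finiteTimeDomain t L (Icc (t L) (t (L + 1))) ∨ (m = L + 1 ∧ s = t (L + 1)) := by
    intro s m
    simp only [mem_finiteTimeDomain, Icc_self, mem_singleton_iff]
    grind
  refine hmax ⟨finiteTimeDomain t (L + 1) (Icc (t (L + 1)) (t (L + 1))),
    fun s m => if m = L + 1 then ψ s else ζ s m,
    hsol.modify (isHybridTimeDomain_finiteTimeDomain_Icc h0 ht (L + 1) le_rfl) ?_ ?_ ?_,
    ⟨fun ⟨s, m⟩ hs => (hmem s m).2 (Or.inl hs), fun hss => ?_⟩, fun s m hs => ?_⟩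
  · simp
  · intro l
    rcases lt_trichotomy l (L + 1) with hl | rfl | hl
    · left
      rw [timeSlice_finiteTimeDomain_of_lt hl]
      rcases (Nat.lt_succ_iff.1 hl).lt_or_eq with hl' | rfl
      · simp [timeSlice_finiteTimeDomain_of_lt hl', hl.ne]
      · simp [timeSlice_finiteTimeDomain_self]
    · right
      simp only [if_true, timeSlice_finiteTimeDomain_self, Icc_self, interior_singleton]
      exact ⟨hψ, fun s hs => hs.elim⟩
    · left
      simp [timeSlice_finiteTimeDomain_of_gt hl,
        timeSlice_finiteTimeDomain_of_gt (L.lt_succ_self.trans hl), hl.ne']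
  · intro s l h1 h2
    rw [mem_finiteTimeDomain] at h2
    have hl : l < L + 1 := by rcases h2 with h2 | h2 <;> omega
    have h1' := ((hmem s l).1 h1).resolve_right fun h => hl.ne h.1
    rcases h2 with h2 | ⟨h2, h3⟩
    · have h2' : (s, l + 1) ∈ finiteTimeDomain t L (Icc (t L) (t (L + 1))) :=
        ((hmem s (l + 1)).1 (mem_finiteTimeDomain.2 (Or.inl h2))).resolve_right
          fun h => h2.1.ne h.1
      simp only [hl.ne, if_false, h2.1.ne]
      exact ⟨hsol.jump_mem s l h1' h2', hsol.jump_eq s l h1' h2'⟩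
    · rw [Icc_self, mem_singleton_iff] at h3
      obtain rfl : l = L := by omega
      subst h3
      simpa [hψ0] using hjump
  · have := hss ((hmem _ _).2 (Or.inr ⟨rfl, rfl⟩))
    rw [mem_finiteTimeDomain] at this
    rcases this with h | h <;> omega
  · have : m ≠ L + 1 := by
      rcases mem_finiteTimeDomain.1 hs with h | h <;> omega
    simp [this]

theorem isCompleteDomain_of_isMaximalSolution {K : Set (ℝ × ℕ)} {ζ : ℝ → ℕ → P.State}
    (h : P.adaptedSystem.IsMaximalSolution K ζ) : HybridSystem.IsCompleteDomain K := by
  by_contra hb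
  obtain ⟨t, L, I, h0, ht, rfl, hL, hI⟩ := h.1.timeDomain.exists_eq_finiteTimeDomain hb
  obtain ⟨φ, hφ0, hφ⟩ := P.exists_isTrajectory (t L) (ζ (t L) L)
  have hI' : I.OrdConnected ∧ I ⊆ Ici (t L) := by
    rcases hI with rfl | rfl
    exacts [⟨ordConnected_Icc, Icc_subset_Ici_self⟩, ⟨ordConnected_Ico, Ico_subset_Ici_self⟩]
  have hS := timeSlice_finiteTimeDomain_self (t := t) (L := L) (I := I)
  have hφζ : ∀ s ∈ I, ζ s L = φ s := fun s hs =>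
    eqOn_isTrajectory h.1 (hS.symm ▸ hI'.1) (hS.ge hL) (hS.le.trans hI'.2) hφ hφ0 s (hS.ge hs)
  -- The last arc starts either at the initial state, in F ∪ G = Λ, or at an image of the jump map.
  have hLam : ∀ s, φ s ∈ P.Lam := by
    refine hφ.mem_Lam (s := t L) ?_
    rw [hφ0]
    rcases L with _ | L
    · rw [h0]
      exact P.flowSet_union_jumpSet.le h.1.init
    · have h1 : (t (L + 1), L) ∈ finiteTimeDomain t (L + 1) I :=
        mem_finiteTimeDomain.2 (Or.inl ⟨L.lt_succ_self, right_mem_Icc.2 (ht L.le_succ)⟩)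
      have h2 : (t (L + 1), L + 1) ∈ finiteTimeDomain t (L + 1) I :=
        mem_finiteTimeDomain.2 (Or.inr ⟨rfl, hL⟩)
      rw [h.1.jump_eq _ _ h1 h2]
      exact jumpMap_mem_Lam (P.jumpSet_subset_Lam (h.1.jump_mem _ _ h1 h2))
  have hflow := fun b => mem_of_isMaximalSolution h0 ht hL hI h hφ hφζ (b := b)
  -- Taking `b = t (L + 1)` asks for no further flow, so the right endpoint already lies in `I`,
  -- which rules out the half-open case.
  have hbI := hflow _ le_rfl fun s h1 h2 => absurd h2 h1.not_gt
  obtain rfl : I = Icc (t L) (t (L + 1)) := hI.resolve_right fun h => by simp [h] at hbI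
  have hG := notMem_jumpSet_of_isMaximalSolution h0 ht h
  rw [hφζ _ hbI] at hG
  obtain ⟨ε, hε, hball⟩ := Metric.isOpen_iff.1 (hφ.isClosed_jumpSet (hLam 0)).isOpen_compl _ hG
  -- The trajectory avoids G, hence remains in F, for a further time `ε`; maximality would put `t (L
  -- + 1) + ε` in `I`.
  have := hflow (t (L + 1) + ε) (by linarith) fun s h1 h2 =>
    mem_flowSet_of_notMem_jumpSet (hLam s) (hball (by
      rw [Metric.mem_ball, Real.dist_eq, abs_of_nonneg (by linarith)]
      linarith))
  linarith [this.2]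

/-! ### Dwell time of bounded solutions -/

theorem exists_dwell_time {K : Set (ℝ × ℕ)} {ζ : ℝ → ℕ → P.State}
    (h : P.adaptedSystem.IsSolution K ζ) (hb : HybridSystem.IsBoundedOn K ζ) :
    ∃ τ : ℝ, 0 < τ ∧ ∀ (j : N) (t : ℝ) (l : ℕ) (t' : ℝ) (l' : ℕ),
      IsConsecutiveSwitches K ζ j t l t' l' → τ ≤ t' - t := by
  obtain ⟨Cf, hCf⟩ := P.exists_lipschitzWith_flowMap
  obtain ⟨C₀, hC₀⟩ := (hCf.isBounded_image hb).exists_norm_le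
  -- The maximum with 1 makes `C` positive, so that `δ / C` is a valid dwell time; `δ` is the
  -- narrowest hysteresis band.
  let C := max C₀ 1
  have hC1 : 0 < C := lt_max_of_lt_right one_pos
  have hC : ∀ t l, (t, l) ∈ K → ‖P.flowMap (ζ t l)‖ ≤ C := fun t l htl =>
    (hC₀ _ (mem_image_of_mem _ (mem_image_of_mem (fun p : ℝ × ℕ => ζ p.1 p.2) htl))).trans
      (le_max_left _ _)
  obtain ⟨δ, hδ, hδj⟩ : ∃ δ : ℝ, 0 < δ ∧ ∀ j, δ ≤ P.ω1 j - P.ω0 j := by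
    rcases isEmpty_or_nonempty N with hN | hN
    · exact ⟨1, one_pos, fun j => hN.elim j⟩
    · obtain ⟨i, hi⟩ := Finite.exists_min fun j => P.ω1 j - P.ω0 j
      exact ⟨_, sub_pos.2 (P.ω0_lt_ω1 i), hi⟩
  refine ⟨δ / C, div_pos hδ hC1, fun j t l t' l' ⟨hs, hs', hll, hns⟩ => ?_⟩
  obtain ⟨hσ, hω⟩ := σ_eq_and_ω_sub_le h hC hs hns hll le_rfl hs'.1
  have hcases : ∀ t l, IsSwitch K ζ j t l → _ := fun t l hs =>
    σ_jumpMap_cases (P.jumpSet_subset_Lam (h.jump_mem t l hs.1 hs.2.1))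
      (j := j) (by have := hs.2.2; rwa [h.jump_eq t l hs.1 hs.2.1] at this)
  have h1 := hcases t l hs
  have h2 := hcases t' l' hs'
  rw [h.jump_eq t l hs.1 hs.2.1] at hσ
  change State.σ (ζ t' l') j = State.σ (P.jumpMap (ζ t l)) j at hσ
  -- Two consecutive switches in the same direction contradict `hσ`; opposite ones occur on opposite
  -- sides of the band.
  have hgap : P.ω1 j - P.ω0 j ≤ |State.ω (ζ t' l') j - State.ω (ζ t l) j| := by
    rcases h1 with ⟨-, h1, h1'⟩ | ⟨-, h1, h1'⟩ <;> rcases h2 with ⟨h2, -, h2'⟩ | ⟨h2, -, h2'⟩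
    · rw [hσ, h1] at h2
      norm_num at h2
    · rw [abs_sub_comm]
      exact (by linarith : _ ≤ _).trans (le_abs_self _)
    · exact (by linarith : _ ≤ _).trans (le_abs_self _)
    · rw [hσ, h1] at h2
      norm_num at h2
  rw [div_le_iff₀ hC1, mul_comm]
  exact (hδj j).trans (hgap.trans hω)

end PowerNetwork

theorem mainTheorem8 {N : Type*} [Fintype N] [DecidableEq N] (P : PowerNetwork N) :
    -- a complete solution exists from every initial condition in `Λ`
    (∀ ζ₀ ∈ P.Lam, ∃ (K : Set (ℝ × ℕ)) (ζ : ℝ → ℕ → P.State),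
      P.adaptedSystem.IsSolution K ζ ∧ ζ 0 0 = ζ₀ ∧ HybridSystem.IsCompleteDomain K) ∧
    -- all maximal solutions are complete
    (∀ (K : Set (ℝ × ℕ)) (ζ : ℝ → ℕ → P.State),
      P.adaptedSystem.IsMaximalSolution K ζ → HybridSystem.IsCompleteDomain K) ∧
    -- complete bounded solutions have a positive dwell time
    (∀ (K : Set (ℝ × ℕ)) (ζ : ℝ → ℕ → P.State),
      P.adaptedSystem.IsSolution K ζ → HybridSystem.IsCompleteDomain K →
      HybridSystem.IsBoundedOn K ζ →
      ∃ τ : ℝ, 0 < τ ∧ ∀ (j : N) (t : ℝ) (l : ℕ) (t' : ℝ) (l' : ℕ),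
        PowerNetwork.IsConsecutiveSwitches K ζ j t l t' l' → τ ≤ t' - t) :=
  ⟨P.exists_complete_solution,
    fun _ _ h => PowerNetwork.isCompleteDomain_of_isMaximalSolution h,
    fun _ _ h _ hb => PowerNetwork.exists_dwell_time h hb⟩
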